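/- Let $d\ge 1$, let $|\cdot|$ be the Euclidean norm and $\mathcal L$ Lebesgue measure on $\mathbb R^d$, let $\omega_d$ be the volume of the unit ball of $\mathbb R^d$, and put $q(x)=(x-1-\log x)/x$ for $x>0$. Given a set of centers $\Xi\subset\mathbb R^d$ and an appetite $\alpha\in(0,\infty)$, an allocation is a measurable map $\psi:\mathbb R^d\to\Xi\cup\{\infty,\Delta\}$ with $\mathcal L\psi^{-1}(\Delta)=0$ and $\mathcal L\psi^{-1}(\xi)\le\alpha$ for every $\xi\in\Xi$. A center $\xi$ is sated if $\mathcal L\psi^{-1}(\xi)=\alpha$; a site $x$ is unclaimed if $\psi(x)=\infty$. For $\psi(x)\notin\{\xi,\Delta\}$, the site $x$ desires $\xi$ if $x$ is unclaimed or $|x-\xi|<|x-\psi(x)|$, and $\xi$ covets $x$ if $\xi$ is not sated or $|x-\xi|<|x'-\xi|$ for some $x'\in\psi^{-1}(\xi)$. The allocation is stable if there is no pair $(x,\xi)$ such that $x$ desires $\xi$ and $\xi$ covets $x$. Let $\Pi$ be a Poisson process on $\mathbb R^d$ of intensity $1$ with support $[\Pi]$. (i) Let $\alpha>2^d$ and let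 $\Psi$ be any (random) map that is almost surely a stable allocation of $\mathbb R^d$ to $[\Pi]$ with appetite $\alpha$. Let $X=|\Psi(0)|$, with $X=\infty$ if $0$ is unclaimed; if $\Psi(0)=\Delta$ let $X$ be the essential $\limsup$ of $|\Psi(y)-y|$ as $y\to0$ (with value $\infty$ at unclaimed $y$). Then $\mathbf E\,e^{cX^d}<\infty$ for every real $c<\omega_d\,q(\alpha/2^d)$. (ii) Let $0<\alpha<2^{-d}$ and let $\Psi^*$ be any (random) map that is almost surely a stable allocation of $\mathbb R^d$ to $[\Pi]\cup\{0\}$ with appetite $\alpha$. Let $R^*=\operatorname{ess\,sup}_{x\in(\Psi^*)^{-1}(0)}|x|$ be the radius of the territory of the center $0$. Then $\mathbf E\,e^{c(R^*)^d}<\infty$ for every real $c<2^d\omega_d\,q(\alpha2^d)$. Here $\mathbf E$ is the upper expectation (the infimum of the expectations of measurable almost sure upper bounds), which is the ordinary expectation whenever its argument is measurable. -/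

import Mathlib

open MeasureTheory ProbabilityTheory Filter Topology
open scoped ENNReal NNReal

noncomputable section

namespace StableMarriage

/-- `ℝ^d` with the Euclidean norm; its `volume` is Lebesgue measure. -/
abbrev Space (d : ℕ) : Type := EuclideanSpace ℝ (Fin d)

/-- The possible values `ξ` (a center), `∞` (unclaimed) and `Δ` (exceptional) of an allocation. -/
inductive Allotment (d : ℕ) : Type
  | center (ξ : Space d) : Allotment d
  | unclaimed : Allotment d
  | exceptional : Allotment d

/-- The territory `ψ⁻¹(ξ)` of `ξ`. -/
def territory {d : ℕ} (ψ : Space d → Allotment d) (ξ : Space d) : Set (Space d) :=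
  {x | ψ x = Allotment.center ξ}

/-- `ψ` is an allocation of `ℝ^d` to the set of centers `C` with appetite `α`.
Since a discrete `C` is countable, measurability of `ψ` as a map into `C ∪ {∞, Δ}` is
measurability of its fibres. -/
structure IsAllocation {d : ℕ} (α : ℝ≥0∞) (C : Set (Space d))
    (ψ : Space d → Allotment d) : Prop where
  center_mem : ∀ x ξ, ψ x = Allotment.center ξ → ξ ∈ C
  measurable_fibre : ∀ v : Allotment d, MeasurableSet (ψ ⁻¹' {v})
  exceptional_null : volume {x | ψ x = Allotment.exceptional} = 0
  territory_le : ∀ ξ ∈ C, volume (territory ψ ξ) ≤ α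

/-- The center `ξ` is sated: its territory has volume `α`. -/
def Sated {d : ℕ} (α : ℝ≥0∞) (ψ : Space d → Allotment d) (ξ : Space d) : Prop :=
  volume (territory ψ ξ) = α

/-- The site `x` desires `ξ`: either `x` is unclaimed, or `x` is claimed by some center that is
strictly further from `x` than `ξ`. (This excludes `ψ x = ξ` and `ψ x = Δ`.) -/
def Desires {d : ℕ} (ψ : Space d → Allotment d) (x ξ : Space d) : Prop :=
  ψ x = Allotment.unclaimed ∨ ∃ η, ψ x = Allotment.center η ∧ dist x ξ < dist x η

/-- The center `ξ` covets the site `x`; used only for `x` with `ψ x ∉ {ξ, Δ}`. -/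
def Covets {d : ℕ} (α : ℝ≥0∞) (ψ : Space d → Allotment d) (ξ x : Space d) : Prop :=
  (∃ x' ∈ territory ψ ξ, dist x ξ < dist x' ξ) ∨ ¬ Sated α ψ ξ

/-- A stable allocation: an allocation without unstable site-center pairs. -/
structure IsStableAllocation {d : ℕ} (α : ℝ≥0∞) (C : Set (Space d))
    (ψ : Space d → Allotment d) : Prop extends IsAllocation α C ψ where
  stable : ∀ x, ∀ ξ ∈ C, ¬ (Desires ψ x ξ ∧ Covets α ψ ξ x)

/-- The distance from `x` to its allotment: `|x - ξ|` for a center `ξ`, and `∞` if unclaimed.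
The value at `Δ` is never relevant below. -/
def Allotment.distFrom {d : ℕ} (x : Space d) : Allotment d → ℝ≥0∞
  | .center ξ => edist x ξ
  | .unclaimed => ∞
  | .exceptional => 0

/-- The distance `X` from the site `x` to its center, `∞` if `x` is unclaimed.
An allocation says nothing about a site `x` in the null set `ψ⁻¹(Δ)`; there we read `X` off from
Lebesgue-almost every site near `x`, as the essential upper limit of their distances. -/
def siteDist {d : ℕ} (ψ : Space d → Allotment d) (x : Space d) : ℝ≥0∞ :=
  match ψ x with
  | .center ξ => edist x ξ
  | .unclaimed => ∞
  | .exceptional => limsup (fun y => (ψ y).distFrom y) (𝓝 x ⊓ ae volume)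

/-- The radius `R(ξ)`, the essential supremum of `|ξ - x|` over the territory of `ξ`. -/
def radius {d : ℕ} (ψ : Space d → Allotment d) (ξ : Space d) : ℝ≥0∞ :=
  essSup (fun x => edist ξ x) (volume.restrict (territory ψ ξ))

/-- The random set `Ξ` is (the support of) a Poisson process on `ℝ^d` of intensity `1`: the number
of points in a Borel set of finite volume is Poisson distributed with mean its volume, and the
numbers of points in finitely many disjoint such sets are independent. -/
structure IsUnitPoissonProcess {d : ℕ} {Ω : Type*} [MeasurableSpace Ω] (P : Measure Ω)
    (Ξ : Ω → Set (Space d)) : Prop where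
  measurable_count : ∀ A : Set (Space d), MeasurableSet A →
    Measurable fun ω => (Ξ ω ∩ A).encard
  law_count : ∀ A : Set (Space d), MeasurableSet A → volume A < ∞ →
    P.map (fun ω => (Ξ ω ∩ A).encard) =
      (poissonMeasure (volume A).toNNReal).map (fun n : ℕ => (n : ℕ∞))
  indep_count : ∀ (n : ℕ) (A : Fin n → Set (Space d)), (∀ i, MeasurableSet (A i)) →
    (∀ i, volume (A i) < ∞) → Pairwise (fun i j => Disjoint (A i) (A j)) →
    iIndepFun (fun i ω => (Ξ ω ∩ A i).encard) P

/-- The upper expectation of `f ≥ 0`, which is the usual expectation when `f` is a random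
variable; it lets us treat all choices of stable allocations, measurable in `ω` or not. -/
def expectation {Ω : Type*} [MeasurableSpace Ω] (P : Measure Ω) (f : Ω → ℝ≥0∞) : ℝ≥0∞ :=
  ⨅ (g : Ω → ℝ≥0∞) (_ : Measurable g) (_ : f ≤ᵐ[P] g), ∫⁻ ω, g ω ∂P

theorem expectation_eq_lintegral {Ω : Type*} [MeasurableSpace Ω] (P : Measure Ω)
    {f : Ω → ℝ≥0∞} (hf : AEMeasurable f P) : expectation P f = ∫⁻ ω, f ω ∂P := by
  apply le_antisymm
  · refine (iInf_le_of_le (hf.mk f) (iInf_le_of_le hf.measurable_mk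
      (iInf_le_of_le hf.ae_eq_mk.le ?_)))
    exact (lintegral_congr_ae hf.ae_eq_mk).ge
  · exact le_iInf fun g => le_iInf fun _ => le_iInf fun h => lintegral_mono_ae h

/-- `e^{c t^d} ∈ [0, ∞]` for `t ∈ [0, ∞]`; at `t = ∞` it is `∞`, `1`, `0` for `c > 0`, `c = 0`,
`c < 0` (when `d ≥ 1`). -/
def expMulPow (c : ℝ) (d : ℕ) (t : ℝ≥0∞) : ℝ≥0∞ :=
  EReal.exp ((c : EReal) * ((t ^ d : ℝ≥0∞) : EReal))

/-- `q(x) = (x - 1 - log x) / x`. -/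
def q (x : ℝ) : ℝ := (x - 1 - Real.log x) / x

/-- The volume `ω_d` of the unit ball of `ℝ^d`. -/
def unitBallVolume (d : ℕ) : ℝ := (volume (Metric.ball (0 : Space d) 1)).toReal

end StableMarriage

end

namespace StableMarriage

/-! Stability turns a large distance into an atypical point count in one ball, and Poisson large
deviations do the rest. If `X > r`, a site at or near the origin desires every center in `B(0,r)`.
None of them covets it, so each is sated with its territory inside `B(0,2r)`. Comparing volumes, the
number `N` of these centers satisfies `N α ≤ ω_d (2r)^d`, that is, `N ≤ l/a` with mean `l = ω_d r^d`
and `a = α/2^d > 1` (`card_mul_le`). If `R* > r`, the origin covets every site of `B(0,r)`, so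
almost all of that ball is served by the origin and the `N` centers in `B(0,2r)`. Hence `N ≥ l/a -
1` with `l = ω_d (2r)^d` and `a = α 2^d < 1` (`volume_ball_le`). Either event has probability at
most a constant times `exp(-l q(a))` (`measure_deviation_le`); taking `r^d = n` and summing over `n`
gives the moments (`expectation_expMulPow_lt_top`). -/

/-! ### Poisson tail bounds -/

/-- The exponential Markov inequality for the Poisson distribution. -/
theorem poissonMeasure_le_of_one_le_mul_pow (r : ℝ≥0) {s D : ℝ} (hs : 0 ≤ s) (hD : 0 ≤ D)
    (S : Set ℕ) (h : ∀ n ∈ S, 1 ≤ D * s ^ n) :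
    poissonMeasure r S ≤ ENNReal.ofReal (D * Real.exp (r * (s - 1))) := by
  have hsum : HasSum (fun n : ℕ => D * Real.exp (-r) * ((r * s) ^ n / n.factorial))
      (D * Real.exp (r * (s - 1))) := by
    have := (NormedSpace.expSeries_div_hasSum_exp ((r : ℝ) * s)).mul_left (D * Real.exp (-r))
    rw [← Real.exp_eq_exp_ℝ, mul_assoc D, ← Real.exp_add] at this
    convert! this using 3
    ring
  calc poissonMeasure r S = ∫⁻ n, S.indicator 1 n ∂poissonMeasure r :=
        (lintegral_indicator_one (MeasurableSet.of_discrete)).symm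
    _ ≤ ∫⁻ n, ENNReal.ofReal (D * s ^ n) ∂poissonMeasure r := by
        refine lintegral_mono fun n => ?_
        by_cases hn : n ∈ S
        · simpa [hn] using h n hn
        · simp [hn]
    _ = ∑' n : ℕ, ENNReal.ofReal (D * Real.exp (-r) * ((r * s) ^ n / n.factorial)) := by
        rw [lintegral_countable']
        refine tsum_congr fun n => ?_
        rw [poissonMeasure_singleton, ← ENNReal.ofReal_mul (by positivity)]
        congr 1
        rw [mul_pow]
        ring
    _ = ENNReal.ofReal (D * Real.exp (r * (s - 1))) := by
        rw [← ENNReal.ofReal_tsum_of_nonneg (fun n => by positivity) hsum.summable, hsum.tsum_eq]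

/-- Both Poisson tails at the ratio `a`: the lower one for `a > 1`, the upper one for `a < 1`. -/
theorem poissonMeasure_le_exp_q (r : ℝ≥0) {a : ℝ} (ha : 0 < a) (k : ℝ) (S : Set ℕ)
    (h : ∀ n ∈ S, 0 ≤ (r / a - n - k) * Real.log a) :
    poissonMeasure r S ≤ ENNReal.ofReal (Real.exp (-(k * Real.log a)) * Real.exp (-(r * q a))) := by
  -- `s = 1/a` is the optimal exponential tilt for the threshold `r/a`; the sign of `log a` decides
  -- which tail is bounded.
  have key := poissonMeasure_le_of_one_le_mul_pow r (s := a⁻¹)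
    (D := Real.exp ((r / a - k) * Real.log a)) (by positivity) (by positivity) S fun n hn => by
      rw [show a⁻¹ ^ n = Real.exp (-(n * Real.log a)) by
        rw [Real.exp_neg, mul_comm, Real.exp_mul, Real.exp_log ha, Real.rpow_natCast, inv_pow],
        ← Real.exp_add]
      refine Real.one_le_exp ?_
      linarith [h n hn]
  refine key.trans_eq ?_
  rw [← Real.exp_add, ← Real.exp_add]
  congr 2
  unfold q
  field_simp
  ring

/-- The event that the number of points in `A` deviates from its mean `l` by the ratio `a`. -/
def deviation {d : ℕ} {Ω : Type*} (Ξ : Ω → Set (Space d)) (A : Set (Space d)) (l a k : ℝ) : Set Ω :=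
  {ω | ∀ n : ℕ, (Ξ ω ∩ A).encard = n → 0 ≤ (l / a - n - k) * Real.log a}

theorem measurableSet_deviation {d : ℕ} {Ω : Type*} [MeasurableSpace Ω] {P : Measure Ω}
    {Ξ : Ω → Set (Space d)} (hΞ : IsUnitPoissonProcess P Ξ) {A : Set (Space d)}
    (hA : MeasurableSet A) (l a k : ℝ) : MeasurableSet (deviation Ξ A l a k) :=
  hΞ.measurable_count A hA
    (MeasurableSet.of_discrete (s := {m : ℕ∞ | ∀ n : ℕ, m = n → 0 ≤ (l / a - n - k) * Real.log a}))

theorem measure_deviation_le {d : ℕ} {Ω : Type*} [MeasurableSpace Ω] {P : Measure Ω}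
    {Ξ : Ω → Set (Space d)} (hΞ : IsUnitPoissonProcess P Ξ) {A : Set (Space d)}
    (hA : MeasurableSet A) {l a : ℝ} (hl : 0 ≤ l) (hAl : volume A = ENNReal.ofReal l)
    (ha : 0 < a) (k : ℝ) :
    P (deviation Ξ A l a k) ≤
      ENNReal.ofReal (Real.exp (-(k * Real.log a)) * Real.exp (-(l * q a))) := by
  set S : Set ℕ∞ := {m | ∀ n : ℕ, m = n → 0 ≤ (l / a - n - k) * Real.log a}
  have hlaw := hΞ.law_count A hA (by simp [hAl])
  -- Infinite counts lie in the event vacuously, at no cost: the law of the count is carried by `ℕ`.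
  have h1 : P (deviation Ξ A l a k) =
      poissonMeasure (volume A).toNNReal ((fun n : ℕ => (n : ℕ∞)) ⁻¹' S) := by
    rw [← Measure.map_apply .of_discrete .of_discrete, ← hlaw,
      Measure.map_apply (hΞ.measurable_count A hA) .of_discrete]
    rfl
  have h2 : (((volume A).toNNReal : ℝ≥0) : ℝ) = l := by
    rw [hAl]
    exact ENNReal.toReal_ofReal hl
  rw [h1, ← h2]
  refine poissonMeasure_le_exp_q _ ha k _ fun n hn => ?_
  rw [h2]
  exact hn n rfl

/-! ### Exponential moments from tail bounds -/

theorem expMulPow_le_one {c : ℝ} (hc : c ≤ 0) (d : ℕ) (t : ℝ≥0∞) : expMulPow c d t ≤ 1 := by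
  unfold expMulPow
  rw [EReal.exp_le_one_iff]
  exact EReal.mul_nonpos_iff.2 (Or.inr ⟨by exact_mod_cast hc, EReal.coe_ennreal_nonneg _⟩)

theorem expMulPow_le_of_pow_le {c : ℝ} (hc : 0 ≤ c) {d : ℕ} {t : ℝ≥0∞} {x : ℝ} (hx : 0 ≤ x)
    (h : t ^ d ≤ ENNReal.ofReal x) : expMulPow c d t ≤ ENNReal.ofReal (Real.exp (c * x)) := by
  unfold expMulPow
  rw [← EReal.exp_coe, EReal.exp_le_exp_iff, EReal.coe_mul]
  refine mul_le_mul_of_nonneg_left ?_ (by exact_mod_cast hc)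
  refine (EReal.coe_ennreal_le_coe_ennreal_iff.2 h).trans_eq ?_
  rw [EReal.coe_ennreal_ofReal, max_eq_left hx]

theorem expectation_le_lintegral {Ω : Type*} [MeasurableSpace Ω] {P : Measure Ω} {f g : Ω → ℝ≥0∞}
    (hg : Measurable g) (h : f ≤ᵐ[P] g) : expectation P f ≤ ∫⁻ ω, g ω ∂P :=
  iInf_le_of_le g (iInf_le_of_le hg (iInf_le _ h))

/-- When `0 < t^d < ∞`, the single term `n = ⌈t^d⌉ - 1` already dominates. The summand `1` covers
`t^d = 0`; at `t^d = ∞` every term is at least `1`, so the sum diverges. -/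
theorem expMulPow_le_tsum {c : ℝ} (hc : 0 ≤ c) {d : ℕ} {Ω : Type*} {A : ℕ → Set Ω} {ω : Ω}
    {t : ℝ≥0∞} (h : ∀ n : ℕ, (n : ℝ≥0∞) < t ^ d → ω ∈ A n) :
    expMulPow c d t ≤
      1 + ∑' n : ℕ, (A n).indicator (fun _ => ENNReal.ofReal (Real.exp (c * (n + 1)))) ω := by
  rcases eq_or_ne (t ^ d) ∞ with ht | ht
  · have hmem : ∀ n, ω ∈ A n := fun n => h n (by simp [ht])
    have : ∑' n : ℕ, (A n).indicator (fun _ => ENNReal.ofReal (Real.exp (c * (n + 1)))) ω = ∞ := by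
      refine top_unique ?_
      rw [← ENNReal.tsum_const_eq_top_of_ne_zero (α := ℕ) (c := 1) one_ne_zero]
      refine ENNReal.tsum_le_tsum fun n => ?_
      rw [Set.indicator_of_mem (hmem n), ENNReal.one_le_ofReal]
      exact Real.one_le_exp (by positivity)
    simp [this]
  · rcases eq_or_ne (t ^ d) 0 with h0 | h0
    · exact le_add_right (by simp [expMulPow, h0])
    · obtain ⟨m, hm⟩ : ∃ m : ℕ, t ^ d ≤ m := (ENNReal.exists_nat_gt ht).imp fun _ => le_of_lt
      classical
      have hex : ∃ m : ℕ, t ^ d ≤ m := ⟨m, hm⟩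
      obtain ⟨n, hn⟩ : ∃ n, Nat.find hex = n + 1 := by
        refine Nat.exists_eq_succ_of_ne_zero fun hz => h0 ?_
        have := Nat.find_spec hex
        rw [hz] at this
        simpa using this
      have hle : t ^ d ≤ ENNReal.ofReal (n + 1) := by
        have := Nat.find_spec hex
        rw [hn] at this
        rw [← Nat.cast_add_one, ENNReal.ofReal_natCast]
        exact this
      have hlt : (n : ℝ≥0∞) < t ^ d := by
        have := Nat.find_min hex (m := n) (by omega)
        exact not_le.1 this
      refine le_add_left (le_trans ?_ (ENNReal.le_tsum n))
      rw [Set.indicator_of_mem (h n hlt)]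
      exact expMulPow_le_of_pow_le hc (by positivity) hle

/-- For `c ≥ 0` the tail sum is dominated by a geometric series of ratio `exp(c - b)`; for `c ≤ 0`
the integrand is at most `1`. -/
theorem expectation_expMulPow_lt_top {d : ℕ} {Ω : Type*} [MeasurableSpace Ω] {P : Measure Ω}
    [IsProbabilityMeasure P] {X : Ω → ℝ≥0∞} {A : ℕ → Set Ω} (hA : ∀ n, MeasurableSet (A n))
    (hX : ∀ᵐ ω ∂P, ∀ n : ℕ, (n : ℝ≥0∞) < X ω ^ d → ω ∈ A n) {K b c : ℝ}
    (hP : ∀ n : ℕ, P (A n) ≤ ENNReal.ofReal (K * Real.exp (-(b * n)))) (hc : c < b) :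
    expectation P (fun ω => expMulPow c d (X ω)) < ∞ := by
  rcases le_total c 0 with hc0 | hc0
  · refine (expectation_le_lintegral (g := fun _ => 1) measurable_const
      (ae_of_all _ fun ω => expMulPow_le_one hc0 d (X ω))).trans_lt ?_
    simp
  · have hmeas : ∀ n, Measurable
        ((A n).indicator fun _ : Ω => ENNReal.ofReal (Real.exp (c * (n + 1)))) :=
      fun n => measurable_const.indicator (hA n)
    refine (expectation_le_lintegral (measurable_const.add (Measurable.tsum hmeas))
      (hX.mono fun ω h => expMulPow_le_tsum hc0 h)).trans_lt ?_
    simp only [Pi.add_apply]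
    rw [lintegral_add_left measurable_const, lintegral_tsum fun n => (hmeas n).aemeasurable]
    refine ENNReal.add_lt_top.2 ⟨by simp, ?_⟩
    have hgeo : Summable fun n : ℕ => K * Real.exp c * Real.exp (c - b) ^ n :=
      (summable_geometric_of_lt_one (Real.exp_pos _).le
        (Real.exp_lt_one_iff.2 (by linarith))).mul_left _
    refine lt_of_le_of_lt (ENNReal.tsum_le_tsum fun n => ?_) hgeo.tsum_ofReal_lt_top
    rw [lintegral_indicator_const (hA n)]
    refine (mul_le_mul_right (hP n) _).trans_eq ?_
    rw [← ENNReal.ofReal_mul (Real.exp_pos _).le, ← Real.exp_nat_mul]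
    congr 1
    rw [mul_left_comm, mul_assoc, ← Real.exp_add, ← Real.exp_add]
    ring_nf

/-! ### Geometry of stable allocations -/

theorem pairwise_disjoint_territory {d : ℕ} (ψ : Space d → Allotment d) :
    Pairwise (Function.onFun Disjoint (territory ψ)) := by
  intro ξ η hne
  refine Set.disjoint_left.2 fun x hx hy => hne ?_
  exact Allotment.center.inj (Eq.trans (Eq.symm hx) hy)

theorem IsAllocation.measurableSet_territory {d : ℕ} {α : ℝ≥0∞} {C : Set (Space d)}
    {ψ : Space d → Allotment d} (h : IsAllocation α C ψ) (ξ : Space d) :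
    MeasurableSet (territory ψ ξ) :=
  h.measurable_fibre (.center ξ)

theorem volume_ball_eq {d : ℕ} (hd : 1 ≤ d) {r : ℝ} (hr : 0 ≤ r) :
    volume (Metric.ball (0 : Space d) r) = ENNReal.ofReal (r ^ d * unitBallVolume d) := by
  have : Nonempty (Fin d) := ⟨⟨0, hd⟩⟩
  rw [Measure.addHaar_ball _ _ hr, ENNReal.ofReal_mul (by positivity), unitBallVolume,
    ENNReal.ofReal_toReal measure_ball_lt_top.ne, finrank_euclideanSpace_fin]

/-- If `x` is further than `r` from its center, then so are sites arbitrarily close to `x` which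
are not exceptional. -/
theorem exists_dist_lt_of_lt_siteDist {d : ℕ} {ψ : Space d → Allotment d} {x : Space d}
    {r : ℝ≥0∞} (h : r < siteDist ψ x) {ε : ℝ} (hε : 0 < ε) :
    ∃ y, dist y x < ε ∧ r < (ψ y).distFrom y := by
  unfold siteDist at h
  split at h
  · next ξ hξ => exact ⟨x, by simpa using hε, by rw [hξ]; exact h⟩
  · next hξ => exact ⟨x, by simpa using hε, by rw [hξ]; exact h⟩
  · have hev : ∀ᶠ y in 𝓝 x ⊓ ae (volume : Measure (Space d)), dist y x < ε :=
      Filter.Eventually.filter_mono inf_le_left (Metric.ball_mem_nhds x hε)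
    obtain ⟨y, hy, hy'⟩ := ((frequently_lt_of_lt_limsup (by isBoundedDefault) h).and_eventually
      hev).exists
    exact ⟨y, hy', hy⟩

theorem desires_of_lt_distFrom {d : ℕ} {ψ : Space d → Allotment d} {y ξ : Space d}
    (h : edist y ξ < (ψ y).distFrom y) : Desires ψ y ξ := by
  unfold Desires
  generalize ψ y = v at h
  cases v with
  | center η =>
    refine Or.inr ⟨η, rfl, ?_⟩
    rw [Allotment.distFrom, edist_dist, edist_dist] at h
    exact (ENNReal.ofReal_lt_ofReal_iff_of_nonneg dist_nonneg).1 h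
  | unclaimed => exact Or.inl rfl
  | exceptional => exact absurd h (by simp [Allotment.distFrom])

/-- If the origin is further than `r` from its center, then every center in the open ball of
radius `r` is sated, with its territory within the ball of radius `2 * r`. -/
theorem IsStableAllocation.sated_and_territory_subset {d : ℕ} {α : ℝ≥0∞} {C : Set (Space d)}
    {ψ : Space d → Allotment d} (h : IsStableAllocation α C ψ) {r : ℝ}
    (hr : ENNReal.ofReal r < siteDist ψ 0) {ξ : Space d} (hξ : ξ ∈ C) (hξr : ‖ξ‖ < r) :
    Sated α ψ ξ ∧ territory ψ ξ ⊆ Metric.ball 0 (2 * r) := by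
  -- The margin `r - ‖ξ‖` keeps `y` within `r` of `ξ` when `y` replaces an exceptional origin.
  obtain ⟨y, hy, hyr⟩ := exists_dist_lt_of_lt_siteDist hr (sub_pos.2 hξr)
  have hyξ : dist y ξ < r := by
    have := dist_triangle y 0 ξ
    rw [dist_zero_left] at this
    linarith
  have hdes : Desires ψ y ξ := by
    refine desires_of_lt_distFrom (lt_of_le_of_lt ?_ hyr)
    rw [edist_dist]
    exact ENNReal.ofReal_le_ofReal hyξ.le
  have hcov : ¬ Covets α ψ ξ y := fun hc => h.stable y ξ hξ ⟨hdes, hc⟩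
  unfold Covets at hcov
  push Not at hcov
  refine ⟨hcov.2, fun x hx => ?_⟩
  have h1 := hcov.1 x hx
  have h2 := dist_triangle x ξ 0
  rw [dist_zero_right ξ] at h2
  rw [Metric.mem_ball]
  linarith

theorem IsStableAllocation.card_mul_le {d : ℕ} {α : ℝ≥0∞} {C : Set (Space d)}
    {ψ : Space d → Allotment d} (h : IsStableAllocation α C ψ) {r : ℝ}
    (hr : ENNReal.ofReal r < siteDist ψ 0) {n : ℕ}
    (hn : (C ∩ Metric.ball 0 r).encard = n) :
    n * α ≤ volume (Metric.ball (0 : Space d) (2 * r)) := by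
  have hfin : (C ∩ Metric.ball 0 r).Finite := Set.finite_of_encard_eq_coe hn
  have hmem : ∀ ξ ∈ hfin.toFinset, Sated α ψ ξ ∧ territory ψ ξ ⊆ Metric.ball 0 (2 * r) := by
    intro ξ hξ
    rw [Set.Finite.mem_toFinset] at hξ
    exact h.sated_and_territory_subset hr hξ.1 (by simpa using hξ.2)
  have hcard : hfin.toFinset.card = n := by
    rw [hfin.encard_eq_coe_toFinset_card] at hn
    exact_mod_cast hn
  calc n * α = ∑ ξ ∈ hfin.toFinset, volume (territory ψ ξ) := by
        rw [Finset.sum_congr rfl fun ξ hξ => (hmem ξ hξ).1, Finset.sum_const, hcard,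
          nsmul_eq_mul]
    _ = volume (⋃ ξ ∈ hfin.toFinset, territory ψ ξ) :=
        (measure_biUnion_finset (fun ξ _ η _ hne => pairwise_disjoint_territory ψ hne)
          fun ξ _ => h.measurableSet_territory ξ).symm
    _ ≤ volume (Metric.ball (0 : Space d) (2 * r)) :=
        measure_mono (Set.iUnion₂_subset fun ξ hξ => (hmem ξ hξ).2)

theorem exists_mem_territory_of_lt_radius {d : ℕ} {ψ : Space d → Allotment d} {ξ : Space d}
    (hm : MeasurableSet (territory ψ ξ)) {r : ℝ≥0∞} (h : r < radius ψ ξ) :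
    ∃ x ∈ territory ψ ξ, r < edist ξ x := by
  by_contra! hcon
  refine not_le.2 h (essSup_le_of_ae_le r ?_)
  exact (ae_restrict_iff' hm).2 (ae_of_all _ hcon)

/-- If the territory of the origin reaches further than `r`, then the ball of radius `r` is
shared by the origin and the centers in the ball of radius `2 * r`. -/
theorem IsStableAllocation.volume_ball_le {d : ℕ} {α : ℝ≥0∞} {C : Set (Space d)}
    {ψ : Space d → Allotment d} (h : IsStableAllocation α (C ∪ {0}) ψ) {r : ℝ} (hr0 : 0 ≤ r)
    (hr : ENNReal.ofReal r < radius ψ 0) {n : ℕ}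
    (hn : (C ∩ Metric.ball 0 (2 * r)).encard = n) :
    volume (Metric.ball (0 : Space d) r) ≤ (n + 1) * α := by
  classical
  obtain ⟨x, hx, hxr⟩ := exists_mem_territory_of_lt_radius (h.measurableSet_territory 0) hr
  have hxr' : r < dist x 0 := by
    rwa [edist_comm, edist_dist, ENNReal.ofReal_lt_ofReal_iff_of_nonneg hr0] at hxr
  have hfin : (C ∩ Metric.ball 0 (2 * r)).Finite := Set.finite_of_encard_eq_coe hn
  have hcard : hfin.toFinset.card = n := by
    rw [hfin.encard_eq_coe_toFinset_card] at hn
    exact_mod_cast hn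
  have hsub : Metric.ball (0 : Space d) r ⊆
      {x | ψ x = Allotment.exceptional} ∪ ⋃ ξ ∈ insert 0 hfin.toFinset, territory ψ ξ := by
    intro y hy
    rw [Metric.mem_ball] at hy
    -- The origin owns `x`, which is farther away than `y`, so it covets `y`.
    have hdes : ¬ Desires ψ y 0 := fun hd =>
      h.stable y 0 (by simp) ⟨hd, Or.inl ⟨x, hx, hy.trans hxr'⟩⟩
    unfold Desires at hdes
    push Not at hdes
    rcases hv : ψ y with η | _ | _
    · refine Or.inr (Set.mem_iUnion₂.2 ⟨η, ?_, hv⟩)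
      -- The center `η` is no farther from `y` than the origin is, so `‖η‖ ≤ 2‖y‖ < 2r`.
      have h1 := hdes.2 η hv
      rcases h.center_mem y η hv with hη | hη
      · refine Finset.mem_insert_of_mem (hfin.mem_toFinset.2 ⟨hη, ?_⟩)
        have h2 := dist_triangle η y 0
        rw [dist_comm η y] at h2
        rw [Metric.mem_ball]
        linarith
      · exact Finset.mem_insert.2 (Or.inl hη)
    · exact absurd hv hdes.1
    · exact Or.inl hv
  calc volume (Metric.ball (0 : Space d) r)
      ≤ volume {x | ψ x = Allotment.exceptional} +
          volume (⋃ ξ ∈ insert 0 hfin.toFinset, territory ψ ξ) :=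
        (measure_mono hsub).trans (measure_union_le _ _)
    _ ≤ ∑ ξ ∈ insert 0 hfin.toFinset, volume (territory ψ ξ) := by
        rw [h.exceptional_null, zero_add]
        exact measure_biUnion_finset_le _ _
    _ ≤ ∑ _ξ ∈ insert 0 hfin.toFinset, α := by
        refine Finset.sum_le_sum fun ξ hξ => h.territory_le ξ ?_
        rcases Finset.mem_insert.1 hξ with hξ | hξ
        · exact Or.inr hξ
        · exact Or.inl (hfin.mem_toFinset.1 hξ).1
    _ ≤ (n + 1) * α := by
        rw [Finset.sum_const, nsmul_eq_mul]
        gcongr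
        rw [← hcard]
        -- Only an inequality, since `0` may already belong to `C`.
        exact_mod_cast Finset.card_insert_le _ _

/-- The radius of the ball whose volume is `n` times that of the unit ball. -/
noncomputable def scale (d n : ℕ) : ℝ := (n : ℝ) ^ (d : ℝ)⁻¹

theorem scale_nonneg (d n : ℕ) : 0 ≤ scale d n := by unfold scale; positivity

theorem scale_pow {d : ℕ} (hd : 1 ≤ d) (n : ℕ) : scale d n ^ d = n :=
  Real.rpow_inv_natCast_pow (by positivity) (by omega)

theorem ofReal_scale_lt {d : ℕ} (hd : 1 ≤ d) {n : ℕ} {t : ℝ≥0∞} (h : (n : ℝ≥0∞) < t ^ d) :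
    ENNReal.ofReal (scale d n) < t := by
  contrapose! h
  refine (pow_le_pow_left' h d).trans_eq ?_
  rw [← ENNReal.ofReal_pow (scale_nonneg d n), scale_pow hd, ENNReal.ofReal_natCast]

end StableMarriage

/-! ### Combining geometry and Poisson tails -/

theorem mainTheorem7 (d : ℕ) (hd : 1 ≤ d) {Ω : Type*} [MeasurableSpace Ω]
    (P : Measure Ω) [IsProbabilityMeasure P] (Ξ : Ω → Set (StableMarriage.Space d))
    (hΞ : StableMarriage.IsUnitPoissonProcess P Ξ) (α c : ℝ) :
    ((2 : ℝ) ^ d < α → c < StableMarriage.unitBallVolume d * StableMarriage.q (α / 2 ^ d) →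
      ∀ Ψ : Ω → StableMarriage.Space d → StableMarriage.Allotment d,
        (∀ᵐ ω ∂P, StableMarriage.IsStableAllocation (ENNReal.ofReal α) (Ξ ω) (Ψ ω)) →
        StableMarriage.expectation P
          (fun ω => StableMarriage.expMulPow c d (StableMarriage.siteDist (Ψ ω) 0)) < ∞) ∧
    (0 < α → α < ((2 : ℝ) ^ d)⁻¹ →
      c < 2 ^ d * StableMarriage.unitBallVolume d * StableMarriage.q (α * 2 ^ d) →
      ∀ Ψ : Ω → StableMarriage.Space d → StableMarriage.Allotment d,
        (∀ᵐ ω ∂P, StableMarriage.IsStableAllocation (ENNReal.ofReal α) (Ξ ω ∪ {0}) (Ψ ω)) →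
        StableMarriage.expectation P
          (fun ω => StableMarriage.expMulPow c d (StableMarriage.radius (Ψ ω) 0)) < ∞) := by
  open StableMarriage in
  have hω : 0 ≤ unitBallVolume d := ENNReal.toReal_nonneg
  have h2 : (0 : ℝ) < 2 ^ d := by positivity
  constructor
  · intro hα hc Ψ hΨ
    have hα0 : 0 < α := h2.trans hα
    have ha : 1 < α / 2 ^ d := by rwa [one_lt_div h2]
    have hvol (n : ℕ) : volume (Metric.ball (0 : Space d) (scale d n)) =
        ENNReal.ofReal (n * unitBallVolume d) := by
      rw [volume_ball_eq hd (scale_nonneg d n), scale_pow hd]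
    refine expectation_expMulPow_lt_top (K := Real.exp (-(0 * Real.log (α / 2 ^ d))))
      (fun n => measurableSet_deviation hΞ (measurableSet_ball (x := 0) (ε := scale d n))
        (n * unitBallVolume d) (α / 2 ^ d) 0) ?_
      (fun n => (measure_deviation_le hΞ measurableSet_ball (by positivity) (hvol n)
        (by positivity) 0).trans_eq ?_) hc
    · filter_upwards [hΨ] with ω h n hn m hm
      refine mul_nonneg ?_ (Real.log_nonneg ha.le)
      have key := h.card_mul_le (ofReal_scale_lt hd hn) hm
      rw [volume_ball_eq hd (mul_nonneg zero_le_two (scale_nonneg d n)), mul_pow, scale_pow hd,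
        ← ENNReal.ofReal_natCast, ← ENNReal.ofReal_mul (by positivity),
        ENNReal.ofReal_le_ofReal_iff (by positivity)] at key
      rw [sub_zero, sub_nonneg, div_div_eq_mul_div, le_div_iff₀ hα0]
      linarith
    · ring_nf
  · intro hα0 hα hc Ψ hΨ
    have ha : α * 2 ^ d < 1 := by rwa [← lt_inv_mul_iff₀' h2, mul_one]
    have hvol (n : ℕ) : volume (Metric.ball (0 : Space d) (2 * scale d n)) =
        ENNReal.ofReal (2 ^ d * n * unitBallVolume d) := by
      rw [volume_ball_eq hd (mul_nonneg zero_le_two (scale_nonneg d n)), mul_pow, scale_pow hd]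
    -- The shift `k = 1` accounts for the extra center at the origin; it costs only the constant
    -- factor `1/a`.
    refine expectation_expMulPow_lt_top (K := Real.exp (-(1 * Real.log (α * 2 ^ d))))
      (fun n => measurableSet_deviation hΞ (measurableSet_ball (x := 0) (ε := 2 * scale d n))
        (2 ^ d * n * unitBallVolume d) (α * 2 ^ d) 1) ?_
      (fun n => (measure_deviation_le hΞ measurableSet_ball (by positivity) (hvol n)
        (by positivity) 1).trans_eq ?_) hc
    · filter_upwards [hΨ] with ω h n hn m hm
      -- Here `log a ≤ 0`, so the event requires a large count rather than a small one.
      refine mul_nonneg_of_nonpos_of_nonpos ?_ (Real.log_nonpos (by positivity) ha.le)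
      have key := h.volume_ball_le (scale_nonneg d n) (ofReal_scale_lt hd hn) hm
      rw [volume_ball_eq hd (scale_nonneg d n), scale_pow hd, ← Nat.cast_add_one,
        ← ENNReal.ofReal_natCast, ← ENNReal.ofReal_mul (by positivity),
        ENNReal.ofReal_le_ofReal_iff (by positivity)] at key
      push_cast at key
      have : 2 ^ d * n * unitBallVolume d / (α * 2 ^ d) ≤ m + 1 := by
        rw [div_le_iff₀ (by positivity)]
        nlinarith
      linarith
    · ring_nf
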